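/- Let $\mathcal Z$ be a measurable space whose diagonal is measurable in $\mathcal Z\times\mathcal Z$ (for instance a standard Borel space), let $n\ge 0$, and let the permutation group $\Pi(n+1)$ act on $\mathcal Z^{n+1}$ by permuting coordinates. Write $O(z^{n+1})$ for the orbit of $z^{n+1}=(z_1,\dots,z_{n+1})$, $\mathrm{Unif}(O)$ for the law of a uniformly random permutation of a fixed element of the orbit $O$, and $\mathrm{Unif}[O]=\frac1{n+1}\sum_{i=1}^{n+1}\delta_{z_i}$ for $O=O(z^{n+1})$. The set of orbits carries the quotient $\sigma$-algebra. An e-value for exchangeability is a measurable map $\varepsilon:\mathcal Z^{n+1}\to[0,\infty]$ with $\mathrm E^P[\varepsilon]\le 1$ for every exchangeable probability measure $P$ on $\mathcal Z^{n+1}$. It is $U$-optimal against a probability measure $Q$ on $\mathcal Z^{n+1}$ if $\mathrm E^Q[U(\varepsilon')]\le \mathrm E^Q[U(\varepsilon)]$ for every e-value $\varepsilon'$ for exchangeability. We say that $Z^n$ is exchangeable under $Q$ if $Q$ is invariant under all permutations of the first $n$ coordinates (with the last coordinate fixed). Let $U:[0,\infty]\to[0,\infty]$ be nondecreasing, with $U(0)=0$,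 and finite and concave on $[0,\infty)$, differentiable on $(0,\infty)$, with $U'$ continuous and strictly decreasing on $(0,\infty)$, $\lim_{x\downarrow 0}U'(x)=\infty$ and $\lim_{x\to\infty}U'(x)=0$. Put $U'(0)=\infty$ and $U'(\infty)=0$, so that $U'$ is a bijection of $[0,\infty]$ with inverse $(U')^{-1}$. (i) For every probability measure $Q$ under which $Z^n$ is exchangeable there is a Markov kernel $O\mapsto Q^{Z_{n+1}\mid O}$ with $Q^{Z_{n+1}\mid O}\ll \mathrm{Unif}[O]$ for every $O$ which is the conditional distribution under $Q$ of $Z_{n+1}$ given the orbit $O(Z^{n+1})$. (ii) Let $O\mapsto Q^{Z_{n+1}\mid O}$ be any Markov kernel from orbits to $\mathcal Z$ with $Q^{Z_{n+1}\mid O}\ll \mathrm{Unif}[O]$ for every $O$, and let $$\mathrm{LR}^{Z_{n+1}\mid O}=\frac{dQ^{Z_{n+1}\mid O}}{d\,\mathrm{Unif}[O]}.$$ For every probability measure $\nu$ on the set of orbits there is exactly one probability measure $Q$ on $\mathcal Z^{n+1}$ under which $Z^n$ is exchangeable, $O(Z^{n+1})$ has law $\nu$, and $Z_{n+1}$ has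 conditional distribution $Q^{Z_{n+1}\mid O}$ given the orbit $O$. There are constants $\lambda^O\in[0,\infty)$ such that $$\varepsilon^U(z^{n+1})=(U')^{-1}\!\left(\frac{\lambda^{O(z^{n+1})}}{\mathrm{LR}^{Z_{n+1}\mid O(z^{n+1})}(z_{n+1})}\right)\qquad(\text{with } a/0=\infty \text{ for } a>0)$$ satisfies $\mathrm E^{\mathrm{Unif}(O)}[\varepsilon^U]=1$ for every orbit $O$. For any such constants, $\lambda^O>0$ for every $O$, $\varepsilon^U$ is an e-value for exchangeability, and it is $U$-optimal simultaneously against every probability measure $Q$ under which $Z^n$ is exchangeable and $Z_{n+1}$ has conditional distribution $Q^{Z_{n+1}\mid O}$ given the orbit $O$, whatever the law of the orbit (the mixture over orbits) and whatever the exchangeable law of $Z^n$. -/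

import Mathlib

open MeasureTheory ProbabilityTheory Filter Topology
open scoped ENNReal NNReal

noncomputable section

namespace FuzzyConformal

/-- Two tuples are equivalent when one is a permutation of the other. -/
def orbitSetoid (n : ℕ) (Z : Type*) : Setoid (Fin (n + 1) → Z) where
  r z w := ∃ π : Equiv.Perm (Fin (n + 1)), w = z ∘ π
  iseqv :=
    { refl := fun _ => ⟨1, rfl⟩
      symm := by
        rintro z w ⟨π, rfl⟩
        exact ⟨π⁻¹, by ext i; simp⟩
      trans := by
        rintro z w v ⟨π, rfl⟩ ⟨ρ, rfl⟩
        exact ⟨π * ρ, rfl⟩ }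

/-- The set of orbits of the permutation group on `(n + 1)`-tuples. It carries the quotient
σ-algebra, which is the σ-algebra of permutation-invariant measurable sets of tuples. -/
abbrev Orbit (n : ℕ) (Z : Type*) : Type _ := Quotient (orbitSetoid n Z)

/-- The orbit `O(z)` of a tuple `z`. -/
def orbit {n : ℕ} {Z : Type*} (z : Fin (n + 1) → Z) : Orbit n Z := Quotient.mk _ z

/-- The orbit representative `[z]` of the orbit `O`. -/
def rep {n : ℕ} {Z : Type*} (O : Orbit n Z) : Fin (n + 1) → Z := Quotient.out O

variable {Z : Type*} [MeasurableSpace Z] {n : ℕ}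

/-- The law of the tuple is invariant under all permutations of the `n + 1` coordinates. -/
def Exchangeable (P : Measure (Fin (n + 1) → Z)) : Prop :=
  ∀ π : Equiv.Perm (Fin (n + 1)), P.map (fun z => z ∘ π) = P

/-- Exchangeability of the first `n` coordinates: the law of the whole tuple is invariant under
all permutations of the first `n` coordinates, the last one staying in place. -/
def FirstExchangeable (Q : Measure (Fin (n + 1) → Z)) : Prop :=
  ∀ π : Equiv.Perm (Fin (n + 1)), π (Fin.last n) = Fin.last n → Q.map (fun z => z ∘ π) = Q

/-- `Unif(O)`: the uniform distribution on the orbit `O`, the law of a uniformly random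
permutation of the representative. -/
def unifOrbit (O : Orbit n Z) : Measure (Fin (n + 1) → Z) :=
  ((Nat.factorial (n + 1) : ℝ≥0∞))⁻¹ •
    ∑ π : Equiv.Perm (Fin (n + 1)), Measure.dirac (rep O ∘ π)

/-- The uniform distribution on the `n + 1` entries of the tuple `[z]`, counted with
multiplicity. -/
def unifEntries (O : Orbit n Z) : Measure Z :=
  ((n + 1 : ℕ) : ℝ≥0∞)⁻¹ • ∑ i : Fin (n + 1), Measure.dirac (rep O i)

/-- An e-value for exchangeability: a `[0, ∞]`-valued statistic with expectation at most one
under every exchangeable distribution. -/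
structure IsEValue (ε : (Fin (n + 1) → Z) → ℝ≥0∞) : Prop where
  measurable : Measurable ε
  valid : ∀ P : Measure (Fin (n + 1) → Z), IsProbabilityMeasure P → Exchangeable P →
    ∫⁻ z, ε z ∂P ≤ 1

/-- `ε` is an e-value for exchangeability that maximizes the expected utility under `Q` among
all e-values for exchangeability. -/
def IsOptimalEValue (U : ℝ≥0∞ → ℝ≥0∞) (Q : Measure (Fin (n + 1) → Z))
    (ε : (Fin (n + 1) → Z) → ℝ≥0∞) : Prop :=
  IsEValue ε ∧ ∀ ε' : (Fin (n + 1) → Z) → ℝ≥0∞, IsEValue ε' →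
    ∫⁻ z, U (ε' z) ∂Q ≤ ∫⁻ z, U (ε z) ∂Q

/-- The restriction of `U : [0, ∞] → [0, ∞]` to the finite half-line, as a real function. -/
def realUtility (U : ℝ≥0∞ → ℝ≥0∞) (x : ℝ) : ℝ := (U (ENNReal.ofReal x)).toReal

/-- The regularity conditions on a utility function `U : [0, ∞] → [0, ∞]`. -/
structure RegularUtility (U : ℝ≥0∞ → ℝ≥0∞) : Prop where
  map_zero : U 0 = 0
  mono : Monotone U
  finite : ∀ x, x ≠ ∞ → U x ≠ ∞
  concave : ConcaveOn ℝ (Set.Ici 0) (realUtility U)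
  differentiable : DifferentiableOn ℝ (realUtility U) (Set.Ioi 0)
  deriv_continuous : ContinuousOn (deriv (realUtility U)) (Set.Ioi 0)
  deriv_strictAnti : StrictAntiOn (deriv (realUtility U)) (Set.Ioi 0)
  deriv_zero : Tendsto (deriv (realUtility U)) (𝓝[>] 0) atTop
  deriv_top : Tendsto (deriv (realUtility U)) atTop (𝓝 0)

/-- The derivative `U'` on `[0, ∞]`, with `U'(0) = ∞` and `U'(∞) = 0`. -/
def extDeriv (U : ℝ≥0∞ → ℝ≥0∞) (x : ℝ≥0∞) : ℝ≥0∞ :=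
  if x = 0 then ∞ else if x = ∞ then 0 else ENNReal.ofReal (deriv (realUtility U) x.toReal)

/-- The inverse `(U')⁻¹` of `U' : [0, ∞] → [0, ∞]`. -/
def invDeriv (U : ℝ≥0∞ → ℝ≥0∞) : ℝ≥0∞ → ℝ≥0∞ := Function.invFun (extDeriv U)

/-- The likelihood ratio of the last observation on an orbit: the density of `κ O`, the
distribution of the last observation on the orbit `O` under the alternative, with respect to
the uniform distribution on the entries of the orbit. -/
def lastLR (κ : Kernel (Orbit n Z) Z) (O : Orbit n Z) (x : Z) : ℝ≥0∞ :=
  (κ O).rnDeriv (unifEntries O) x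

/-- The e-value `(U')⁻¹(lam(O(z)) / LR(z_{n+1}))`; here `a / 0 = ∞` for `a > 0`. -/
def utilityEValue (U : ℝ≥0∞ → ℝ≥0∞) (κ : Kernel (Orbit n Z) Z) (lam : Orbit n Z → ℝ≥0)
    (z : Fin (n + 1) → Z) : ℝ≥0∞ :=
  invDeriv U ((lam (orbit z) : ℝ≥0∞) / lastLR κ (orbit z) (z (Fin.last n)))

/-- `lam` normalizes the e-value to have expectation exactly one on every orbit. -/
def IsNormalizer (U : ℝ≥0∞ → ℝ≥0∞) (κ : Kernel (Orbit n Z) Z) (lam : Orbit n Z → ℝ≥0) : Prop :=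
  ∀ O : Orbit n Z, ∫⁻ z, utilityEValue U κ lam z ∂(unifOrbit O) = 1

/-- An orbit-dependent distribution of the last observation over the entries of the orbit. -/
def IsOrbitLaw (κ : Kernel (Orbit n Z) Z) : Prop :=
  IsMarkovKernel κ ∧ ∀ O, κ O ≪ unifEntries O

/-- `Q` is a distribution of the tuple under which the first `n` observations are exchangeable
and the last observation has conditional distribution `κ O` given the orbit `O`. -/
structure IsAlternative (κ : Kernel (Orbit n Z) Z) (Q : Measure (Fin (n + 1) → Z)) : Prop where
  prob : IsProbabilityMeasure Q
  first : FirstExchangeable Q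
  cond : HasCondDistrib (fun z : Fin (n + 1) → Z => z (Fin.last n)) orbit κ Q

end FuzzyConformal

end

/-!
A law under which the first `n` observations are exchangeable is, on each orbit, the uniform law
reweighted by a density that depends only on the orbit and the last entry: the likelihood ratio
`LR`. The law is determined by the joint law of the orbit and the last entry, because symmetrizing
a function over the permutations that fix the last coordinate turns it into a function of these
two. For the existence of the orbit-conditional law, the Radon-Nikodym derivative of `Q` with
respect to the mixture of the uniform laws is a probability density on almost every orbit; after it
is replaced by `1` on the other orbits, it defines the kernel everywhere.

For optimality, the tangent to the concave function `U` at `ε = (U')⁻¹(λ / LR)` gives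
`LR * U(ε') + λ * ε ≤ LR * U(ε) + λ * ε'` pointwise. Integrated over an orbit, where `ε` has mean
`1` and an e-value `ε'` has mean at most `1`, the terms with the constant `λ` cancel. Since this
holds on each orbit separately, it does not matter how the orbits are mixed.
-/

noncomputable section

namespace FuzzyConformal

section General

variable {α β : Type*} [MeasurableSpace α] [MeasurableSpace β]

lemma lintegral_inv_card_mul_sum_comp {μ : Measure α} {ι : Type*} [Fintype ι] [Nonempty ι]
    {T : ι → α → α} (hT : ∀ i, MeasurePreserving (T i) μ μ) {f : α → ℝ≥0∞} (hf : Measurable f) :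
    ∫⁻ x, (Fintype.card ι : ℝ≥0∞)⁻¹ * ∑ i, f (T i x) ∂μ = ∫⁻ x, f x ∂μ := by
  have hfT (i : ι) : Measurable fun x => f (T i x) := hf.comp (hT i).measurable
  rw [lintegral_const_mul _ (Finset.measurable_sum _ fun i _ => hfT i),
    lintegral_finsetSum _ fun i _ => hfT i]
  simp only [(hT _).lintegral_comp hf, Finset.sum_const, Finset.card_univ, nsmul_eq_mul]
  rw [← mul_assoc, ENNReal.inv_mul_cancel (by simp) (ENNReal.natCast_ne_top _), one_mul]

lemma map_withDensity_comp (μ : Measure α) {f : α → β} (hf : Measurable f) {g : β → ℝ≥0∞}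
    (hg : Measurable g) : (μ.withDensity (g ∘ f)).map f = (μ.map f).withDensity g := by
  ext s hs
  rw [Measure.map_apply hf hs, withDensity_apply _ (hf hs), withDensity_apply _ hs,
    setLIntegral_map hs hg hf]
  rfl

lemma map_withDensity_of_comp_eq {μ : Measure α} {T : α → α} (hT : MeasurePreserving T μ μ)
    {D : α → ℝ≥0∞} (hD : Measurable D) (hDT : D ∘ T = D) :
    (μ.withDensity D).map T = μ.withDensity D := by
  conv_lhs => rw [← hDT, map_withDensity_comp μ hT.measurable hD, hT.map_eq]

lemma rnDeriv_eq_measure_singleton_div [MeasurableSingletonClass α] {μ ν : Measure α}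
    [μ.HaveLebesgueDecomposition ν] (h : μ ≪ ν) {x : α} (h_zero : ν {x} ≠ 0) (h_top : ν {x} ≠ ∞) :
    μ.rnDeriv ν x = μ {x} / ν {x} := by
  rw [ENNReal.eq_div_iff h_zero h_top, mul_comm]
  conv_rhs => rw [← Measure.withDensity_rnDeriv_eq μ ν h]
  rw [withDensity_apply _ (measurableSet_singleton x), lintegral_singleton]

lemma measurable_kernel_singleton [MeasurableEq β] (κ : Kernel α β) [IsSFiniteKernel κ] :
    Measurable fun p : α × β => κ p.1 {p.2} :=
  Kernel.measurable_kernel_prodMk_left (κ := κ.comap Prod.fst measurable_fst)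
    (measurableSet_eq_fun measurable_snd (measurable_snd.comp measurable_fst))

lemma sum_perm_apply {M : Type*} [AddCommMonoid M] {n : ℕ} (i : Fin (n + 1))
    (g : Fin (n + 1) → M) :
    ∑ π : Equiv.Perm (Fin (n + 1)), g (π i) = n.factorial • ∑ j, g j := by
  calc ∑ π : Equiv.Perm (Fin (n + 1)), g (π i)
    _ = ∑ π : Equiv.Perm (Fin (n + 1)), g (π 0) :=
      Fintype.sum_equiv (Equiv.mulRight (Equiv.swap 0 i)) _ _ (by simp)
    _ = ∑ p : Fin (n + 1) × Equiv.Perm (Fin n), g p.1 :=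
      (Fintype.sum_equiv Equiv.Perm.decomposeFin.symm _ _ (by simp)).symm
    _ = n.factorial • ∑ j, g j := by
      simp [Fintype.sum_prod_type, Finset.smul_sum, Fintype.card_perm]

end General

section Utility

variable {U : ℝ≥0∞ → ℝ≥0∞}

lemma RegularUtility.deriv_pos (hU : RegularUtility U) {x : ℝ} (hx : 0 < x) :
    0 < deriv (realUtility U) x := by
  have hx' : (0 : ℝ) < x + 1 := by linarith
  have h_nonneg : 0 ≤ deriv (realUtility U) (x + 1) := by
    refine le_of_tendsto hU.deriv_top ?_
    filter_upwards [eventually_gt_atTop (x + 1)] with y hy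
    exact (hU.deriv_strictAnti hx' (hx'.trans hy) hy).le
  exact h_nonneg.trans_lt (hU.deriv_strictAnti hx hx' (by linarith))

lemma RegularUtility.exists_deriv_eq (hU : RegularUtility U) {c : ℝ} (hc : 0 < c) :
    ∃ x, 0 < x ∧ deriv (realUtility U) x = c :=
  isPreconnected_Ioi.intermediate_value_Ioi (l₁ := atTop) (l₂ := 𝓝[>] (0 : ℝ))
    (le_principal_iff.2 (Ioi_mem_atTop 0)) (le_principal_iff.2 self_mem_nhdsWithin)
    hU.deriv_continuous hU.deriv_top hU.deriv_zero hc

@[simp] lemma extDeriv_zero : extDeriv U 0 = ∞ := by simp [extDeriv]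

@[simp] lemma extDeriv_top : extDeriv U ∞ = 0 := by simp [extDeriv]

lemma extDeriv_of_ne {x : ℝ≥0∞} (h_zero : x ≠ 0) (h_top : x ≠ ∞) :
    extDeriv U x = ENNReal.ofReal (deriv (realUtility U) x.toReal) := by
  simp only [extDeriv, h_zero, h_top, if_false]

lemma RegularUtility.extDeriv_strictAnti (hU : RegularUtility U) : StrictAnti (extDeriv U) := by
  intro x y hxy
  have hx : x ≠ ∞ := hxy.ne_top
  have hy : y ≠ 0 := hxy.ne_bot
  rcases eq_or_ne x 0 with rfl | hx_zero <;> rcases eq_or_ne y ∞ with rfl | hy_top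
  · simp
  · simp [extDeriv_of_ne hy hy_top]
  · simp [extDeriv_of_ne hx_zero hx, hU.deriv_pos (ENNReal.toReal_pos hx_zero hx)]
  · have hx_pos := ENNReal.toReal_pos hx_zero hx
    rw [extDeriv_of_ne hx_zero hx, extDeriv_of_ne hy hy_top,
      ENNReal.ofReal_lt_ofReal_iff (hU.deriv_pos hx_pos)]
    exact hU.deriv_strictAnti hx_pos (ENNReal.toReal_pos hy hy_top)
      ((ENNReal.toReal_lt_toReal hx hy_top).2 hxy)

lemma RegularUtility.extDeriv_surjective (hU : RegularUtility U) :
    Function.Surjective (extDeriv U) := by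
  intro c
  rcases eq_or_ne c 0 with rfl | hc_zero
  · exact ⟨∞, extDeriv_top⟩
  rcases eq_or_ne c ∞ with rfl | hc_top
  · exact ⟨0, extDeriv_zero⟩
  obtain ⟨x, hx, hxc⟩ := hU.exists_deriv_eq (ENNReal.toReal_pos hc_zero hc_top)
  refine ⟨ENNReal.ofReal x, ?_⟩
  rw [extDeriv_of_ne (ENNReal.ofReal_pos.2 hx).ne' ENNReal.ofReal_ne_top,
    ENNReal.toReal_ofReal hx.le, hxc, ENNReal.ofReal_toReal hc_top]

lemma RegularUtility.extDeriv_invDeriv (hU : RegularUtility U) (c : ℝ≥0∞) :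
    extDeriv U (invDeriv U c) = c :=
  Function.invFun_eq (hU.extDeriv_surjective c)

lemma RegularUtility.invDeriv_extDeriv (hU : RegularUtility U) (x : ℝ≥0∞) :
    invDeriv U (extDeriv U x) = x :=
  Function.leftInverse_invFun hU.extDeriv_strictAnti.injective x

lemma RegularUtility.invDeriv_zero (hU : RegularUtility U) : invDeriv U 0 = ∞ := by
  rw [← extDeriv_top (U := U), hU.invDeriv_extDeriv]

lemma RegularUtility.invDeriv_top (hU : RegularUtility U) : invDeriv U ∞ = 0 := by
  rw [← extDeriv_zero (U := U), hU.invDeriv_extDeriv]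

lemma RegularUtility.invDeriv_strictAnti (hU : RegularUtility U) : StrictAnti (invDeriv U) := by
  intro a b hab
  rwa [← hU.extDeriv_strictAnti.lt_iff_gt, hU.extDeriv_invDeriv, hU.extDeriv_invDeriv]

lemma RegularUtility.continuous_invDeriv (hU : RegularUtility U) : Continuous (invDeriv U) :=
  continuous_ofDual.comp <| hU.invDeriv_strictAnti.antitone.dual_right.continuous_of_surjective
    fun x => ⟨extDeriv U (OrderDual.ofDual x), congrArg _ (hU.invDeriv_extDeriv _)⟩

lemma RegularUtility.realUtility_le_tangent (hU : RegularUtility U) {x y : ℝ} (hx : 0 < x)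
    (hy : 0 ≤ y) :
    realUtility U y ≤ realUtility U x + deriv (realUtility U) x * (y - x) := by
  have h_deriv : HasDerivAt (realUtility U) (deriv (realUtility U) x) x :=
    (hU.differentiable.differentiableAt (Ioi_mem_nhds hx)).hasDerivAt
  rcases lt_trichotomy x y with hxy | rfl | hyx
  · have := hU.concave.slope_le_of_hasDerivAt hx.le hy hxy h_deriv
    rw [slope_def_field, div_le_iff₀ (sub_pos.2 hxy)] at this
    linarith
  · simp
  · have := hU.concave.le_slope_of_hasDerivAt hy hx.le hyx h_deriv
    rw [slope_def_field, le_div_iff₀ (sub_pos.2 hyx)] at this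
    linarith

lemma RegularUtility.add_extDeriv_mul_le (hU : RegularUtility U) {x y : ℝ≥0∞} (hx_zero : x ≠ 0)
    (hx_top : x ≠ ∞) (hy : y ≠ ∞) :
    U y + extDeriv U x * x ≤ U x + extDeriv U x * y := by
  have hUx := hU.finite x hx_top
  have hUy := hU.finite y hy
  have hx_pos : 0 < x.toReal := ENNReal.toReal_pos hx_zero hx_top
  have h_tangent := hU.realUtility_le_tangent hx_pos (ENNReal.toReal_nonneg (a := y))
  simp only [realUtility, ENNReal.ofReal_toReal hx_top, ENNReal.ofReal_toReal hy] at h_tangent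
  rw [extDeriv_of_ne hx_zero hx_top, ← ENNReal.toReal_le_toReal (by finiteness) (by finiteness),
    ENNReal.toReal_add (by finiteness) (by finiteness),
    ENNReal.toReal_add (by finiteness) (by finiteness), ENNReal.toReal_mul, ENNReal.toReal_mul,
    ENNReal.toReal_ofReal (hU.deriv_pos hx_pos).le]
  linarith

lemma RegularUtility.mul_add_mul_invDeriv_le (hU : RegularUtility U) {l L y : ℝ≥0∞}
    (hl_zero : l ≠ 0) (hl_top : l ≠ ∞) (hL : L ≠ ∞) (hy : y ≠ ∞) :
    L * U y + l * invDeriv U (l / L) ≤ L * U (invDeriv U (l / L)) + l * y := by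
  rcases eq_or_ne L 0 with rfl | hL_zero
  · simp [ENNReal.div_zero hl_zero, hU.invDeriv_top]
  set x := invDeriv U (l / L)
  have hU'x : extDeriv U x = l / L := hU.extDeriv_invDeriv _
  have hx_zero : x ≠ 0 := by
    intro h
    exact ENNReal.div_ne_top hl_top hL_zero (by rw [← hU'x, h, extDeriv_zero])
  have hx_top : x ≠ ∞ := by
    intro h
    exact ENNReal.div_ne_zero.2 ⟨hl_zero, hL⟩ (by rw [← hU'x, h, extDeriv_top])
  calc L * U y + l * x
    _ = L * (U y + l / L * x) := by
      rw [mul_add, ← mul_assoc, ENNReal.mul_div_cancel hL_zero hL]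
    _ ≤ L * (U x + l / L * y) := by
      gcongr L * ?_
      exact hU'x ▸ hU.add_extDeriv_mul_le hx_zero hx_top hy
    _ = L * U x + l * y := by rw [mul_add, ← mul_assoc, ENNReal.mul_div_cancel hL_zero hL]

lemma RegularUtility.lintegral_invDeriv_div_lt (hU : RegularUtility U) {α : Type*}
    [MeasurableSpace α] {μ : Measure α} {L : α → ℝ≥0∞} (hL : AEMeasurable L μ)
    (hL_top : ∀ᵐ x ∂μ, L x ≠ ∞) (hL_zero : ∃ᵐ x ∂μ, L x ≠ 0) {a b : ℝ≥0∞} (hab : a < b)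
    (hb : ∫⁻ x, invDeriv U (b / L x) ∂μ ≠ ∞) :
    ∫⁻ x, invDeriv U (b / L x) ∂μ < ∫⁻ x, invDeriv U (a / L x) ∂μ := by
  refine lintegral_strict_mono_of_ae_le_of_frequently_ae_lt
    (hU.continuous_invDeriv.measurable.comp_aemeasurable (aemeasurable_const.div hL)) hb
    (ae_of_all _ fun x => hU.invDeriv_strictAnti.antitone (ENNReal.div_le_div_right hab.le _))
    ((hL_zero.and_eventually hL_top).mono fun x hx => ?_)
  exact (hU.invDeriv_strictAnti (ENNReal.div_lt_div_right hx.1 hx.2 hab)).ne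

lemma RegularUtility.exists_sum_invDeriv_eq (hU : RegularUtility U) {ι : Type*} [Fintype ι]
    {L : ι → ℝ≥0∞} (hL_top : ∀ i, L i ≠ ∞) (hL_zero : ∃ i, L i ≠ 0) {s : ℝ≥0∞} (hs_zero : s ≠ 0)
    (hs_top : s ≠ ∞) : ∃ l : ℝ≥0, ∑ i, invDeriv U (l / L i) = s := by
  -- Since `0 / 0 = 0`, the terms with `L i = 0` are discontinuous at `l = 0`; for `l > 0` they
  -- vanish, so the intermediate value theorem is applied to the sum of the others.
  let S : ℝ≥0∞ → ℝ≥0∞ := fun l => ∑ i with L i ≠ 0, invDeriv U (l / L i)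
  have hS_cont : Continuous S := continuous_finsetSum _ fun i hi =>
    hU.continuous_invDeriv.comp (ENNReal.continuous_div_const _ (Finset.mem_filter.1 hi).2)
  have hS_zero : S 0 = ∞ := by
    obtain ⟨i, hi⟩ := hL_zero
    exact ENNReal.sum_eq_top.2 ⟨i, by simpa using hi, by simp [hU.invDeriv_zero]⟩
  have hS_top : S ∞ = 0 := Finset.sum_eq_zero fun i _ => by
    rw [ENNReal.top_div_of_ne_top (hL_top i), hU.invDeriv_top]
  obtain ⟨l, hl⟩ : s ∈ Set.range S :=
    mem_range_of_exists_le_of_exists_ge hS_cont ⟨∞, by simp [hS_top]⟩ ⟨0, by simp [hS_zero]⟩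
  have hl_top : l ≠ ∞ := by rintro rfl; exact hs_zero (hl.symm.trans hS_top)
  have hl_zero : l ≠ 0 := by rintro rfl; exact hs_top (hl.symm.trans hS_zero)
  refine ⟨l.toNNReal, ?_⟩
  rw [ENNReal.coe_toNNReal hl_top, ← hl]
  exact (Finset.sum_filter_of_ne fun i _ => mt fun hi => by
    rw [hi, ENNReal.div_zero hl_zero, hU.invDeriv_top]).symm

end Utility

section Orbits

variable {Z : Type*} {n : ℕ}

lemma orbit_comp_perm (z : Fin (n + 1) → Z) (π : Equiv.Perm (Fin (n + 1))) :
    orbit (z ∘ π) = orbit z :=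
  (Quotient.sound ⟨π, rfl⟩ : orbit z = orbit (z ∘ π)).symm

lemma orbit_rep (O : Orbit n Z) : orbit (rep O) = O := Quotient.out_eq O

lemma exists_eq_comp_perm {z w : Fin (n + 1) → Z} (h : orbit w = orbit z) :
    ∃ π : Equiv.Perm (Fin (n + 1)), w = z ∘ π :=
  Quotient.exact h.symm

lemma orbit_surjective : Function.Surjective (orbit : (Fin (n + 1) → Z) → Orbit n Z) :=
  fun O => ⟨rep O, orbit_rep O⟩

lemma exists_perm_fixing_last {z w : Fin (n + 1) → Z} (h : orbit w = orbit z)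
    (h_last : w (Fin.last n) = z (Fin.last n)) :
    ∃ π : Equiv.Perm (Fin (n + 1)), π (Fin.last n) = Fin.last n ∧ w = z ∘ π := by
  obtain ⟨π, rfl⟩ := exists_eq_comp_perm h
  refine ⟨Equiv.swap (π (Fin.last n)) (Fin.last n) * π, by simp, ?_⟩
  ext i
  simp only [Function.comp_apply, Equiv.Perm.mul_apply] at h_last ⊢
  rw [Equiv.swap_apply_def]
  split_ifs with h_first h_second
  · rw [h_first, h_last]
  · rw [h_second, h_last]
  · rfl

variable [MeasurableSpace Z]

@[fun_prop]
lemma measurable_orbit : Measurable (orbit : (Fin (n + 1) → Z) → Orbit n Z) :=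
  measurable_quotient_mk''

lemma measurable_comp_perm (π : Equiv.Perm (Fin (n + 1))) :
    Measurable (fun z : Fin (n + 1) → Z => z ∘ π) := by
  unfold Function.comp; fun_prop

lemma measurable_orbit_last :
    Measurable (fun z : Fin (n + 1) → Z => (orbit z, z (Fin.last n))) :=
  measurable_orbit.prodMk (measurable_pi_apply _)

lemma Exchangeable.measurePreserving {P : Measure (Fin (n + 1) → Z)} (hP : Exchangeable P)
    (π : Equiv.Perm (Fin (n + 1))) : MeasurePreserving (fun z => z ∘ π) P P :=
  ⟨measurable_comp_perm π, hP π⟩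

lemma FirstExchangeable.measurePreserving {Q : Measure (Fin (n + 1) → Z)}
    (hQ : FirstExchangeable Q) {π : Equiv.Perm (Fin (n + 1))} (hπ : π (Fin.last n) = Fin.last n) :
    MeasurePreserving (fun z => z ∘ π) Q Q :=
  ⟨measurable_comp_perm π, hQ π hπ⟩

lemma unifOrbit_orbit (z : Fin (n + 1) → Z) :
    unifOrbit (orbit z) = ((Nat.factorial (n + 1) : ℝ≥0∞))⁻¹ •
      ∑ π : Equiv.Perm (Fin (n + 1)), Measure.dirac (z ∘ π) := by
  obtain ⟨ρ, hρ⟩ := exists_eq_comp_perm (orbit_rep (orbit z))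
  rw [unifOrbit, hρ]
  exact congrArg _ (Fintype.sum_equiv (Equiv.mulLeft ρ) _ _ fun π => rfl)

instance isProbabilityMeasure_unifOrbit (O : Orbit n Z) : IsProbabilityMeasure (unifOrbit O) where
  measure_univ := by
    simp [unifOrbit, Fintype.card_perm,
      ENNReal.inv_mul_cancel (Nat.cast_ne_zero.2 (n + 1).factorial_ne_zero)]

lemma exchangeable_unifOrbit (O : Orbit n Z) : Exchangeable (unifOrbit O) := by
  intro ρ
  rw [unifOrbit, Measure.map_smul, Measure.map_finset_sum (measurable_comp_perm ρ).aemeasurable]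
  simp_rw [Measure.map_dirac' (measurable_comp_perm ρ)]
  exact congrArg _ (Fintype.sum_equiv (Equiv.mulRight ρ) _ _ fun π => rfl)

lemma map_last_unifOrbit (O : Orbit n Z) :
    (unifOrbit O).map (fun w => w (Fin.last n)) = unifEntries O := by
  have h_last : Measurable fun w : Fin (n + 1) → Z => w (Fin.last n) := measurable_pi_apply _
  rw [unifOrbit, Measure.map_smul, Measure.map_finset_sum h_last.aemeasurable]
  simp_rw [Measure.map_dirac' h_last, Function.comp_apply]
  rw [sum_perm_apply (Fin.last n) fun i => Measure.dirac (rep O i), unifEntries,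
    ← Nat.cast_smul_eq_nsmul ℝ≥0∞, smul_smul, Nat.factorial_succ, Nat.cast_mul,
    ENNReal.mul_inv (by simp) (by simp), mul_assoc,
    ENNReal.inv_mul_cancel (Nat.cast_ne_zero.2 n.factorial_ne_zero) (ENNReal.natCast_ne_top _),
    mul_one]

instance isProbabilityMeasure_unifEntries (O : Orbit n Z) :
    IsProbabilityMeasure (unifEntries O) :=
  map_last_unifOrbit O ▸ Measure.isProbabilityMeasure_map (measurable_pi_apply _).aemeasurable

/-- The kernel `O ↦ Unif(O)`. -/
def unifKernel (n : ℕ) (Z : Type*) [MeasurableSpace Z] :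
    Kernel (Orbit n Z) (Fin (n + 1) → Z) where
  toFun := unifOrbit
  measurable' := by
    refine measurable_from_quotient.2 (Measure.measurable_of_measurable_coe _ fun s hs => ?_)
    change Measurable fun z => unifOrbit (orbit z) s
    simp only [unifOrbit_orbit, Measure.smul_apply, Measure.finsetSum_apply, smul_eq_mul,
      Measure.dirac_apply' _ hs]
    exact (Finset.measurable_sum _ fun π _ =>
      (measurable_one.indicator hs).comp (measurable_comp_perm π)).const_mul _

lemma unifKernel_apply (O : Orbit n Z) : unifKernel n Z O = unifOrbit O := rfl

instance isMarkovKernel_unifKernel : IsMarkovKernel (unifKernel n Z) :=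
  ⟨isProbabilityMeasure_unifOrbit⟩

/-- The kernel that sends an orbit to the uniform distribution on its entries. -/
def entriesKernel (n : ℕ) (Z : Type*) [MeasurableSpace Z] : Kernel (Orbit n Z) Z :=
  (unifKernel n Z).map fun w => w (Fin.last n)

lemma entriesKernel_apply (O : Orbit n Z) : entriesKernel n Z O = unifEntries O := by
  rw [entriesKernel, Kernel.map_apply _ (measurable_pi_apply _), unifKernel_apply,
    map_last_unifOrbit]

instance isMarkovKernel_entriesKernel : IsMarkovKernel (entriesKernel n Z) :=
  Kernel.IsMarkovKernel.map _ (measurable_pi_apply _)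

lemma measurable_lintegral_unifOrbit {f : (Fin (n + 1) → Z) → ℝ≥0∞} (hf : Measurable f) :
    Measurable fun O => ∫⁻ w, f w ∂(unifOrbit O) :=
  hf.lintegral_kernel (κ := unifKernel n Z)

lemma IsEValue.lintegral_unifOrbit_le {ε : (Fin (n + 1) → Z) → ℝ≥0∞} (hε : IsEValue ε)
    (O : Orbit n Z) : ∫⁻ z, ε z ∂(unifOrbit O) ≤ 1 :=
  hε.valid _ inferInstance (exchangeable_unifOrbit O)

variable [MeasurableSingletonClass Z]

lemma lintegral_unifOrbit_orbit (z : Fin (n + 1) → Z) (f : (Fin (n + 1) → Z) → ℝ≥0∞) :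
    ∫⁻ w, f w ∂(unifOrbit (orbit z)) =
      (Nat.factorial (n + 1) : ℝ≥0∞)⁻¹ * ∑ π : Equiv.Perm (Fin (n + 1)), f (z ∘ π) := by
  simp [unifOrbit_orbit, lintegral_smul_measure]

lemma ae_unifOrbit_iff {O : Orbit n Z} {p : (Fin (n + 1) → Z) → Prop} :
    (∀ᵐ w ∂(unifOrbit O), p w) ↔ ∀ w, orbit w = O → p w := by
  obtain ⟨z, rfl⟩ := orbit_surjective O
  rw [unifOrbit_orbit, Measure.ae_ennreal_smul_measure_iff (by simp), ae_finsetSum_measure_iff]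
  simp only [Finset.mem_univ, true_imp_iff, ae_dirac_eq, eventually_pure]
  refine ⟨fun h w hw => ?_, fun h π => h _ (orbit_comp_perm z π)⟩
  obtain ⟨π, rfl⟩ := exists_eq_comp_perm hw
  exact h π

lemma IsEValue.ne_top {ε : (Fin (n + 1) → Z) → ℝ≥0∞} (hε : IsEValue ε) (z : Fin (n + 1) → Z) :
    ε z ≠ ∞ := by
  have h_ae : ∀ᵐ w ∂(unifOrbit (orbit z)), ε w < ∞ :=
    ae_lt_top hε.measurable (ne_top_of_le_ne_top ENNReal.one_ne_top (hε.lintegral_unifOrbit_le _))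
  exact (ae_unifOrbit_iff.1 h_ae z rfl).ne

lemma measurableSet_last_eq (x : Z) : MeasurableSet {w : Fin (n + 1) → Z | w (Fin.last n) = x} :=
  (measurableSet_singleton x).preimage (measurable_pi_apply _)

lemma unifOrbit_last_eq_ne_zero (z : Fin (n + 1) → Z) :
    unifOrbit (orbit z) {w | w (Fin.last n) = z (Fin.last n)} ≠ 0 := fun h =>
  ae_unifOrbit_iff.1 (measure_eq_zero_iff_ae_notMem.1 h) z rfl rfl

lemma unifEntries_singleton_last_ne_zero (z : Fin (n + 1) → Z) :
    unifEntries (orbit z) {z (Fin.last n)} ≠ 0 := by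
  rw [← map_last_unifOrbit,
    Measure.map_apply (measurable_pi_apply _) (measurableSet_singleton _)]
  exact unifOrbit_last_eq_ne_zero z

lemma Exchangeable.lintegral_lintegral_unifOrbit {P : Measure (Fin (n + 1) → Z)}
    (hP : Exchangeable P) {f : (Fin (n + 1) → Z) → ℝ≥0∞} (hf : Measurable f) :
    ∫⁻ z, ∫⁻ w, f w ∂(unifOrbit (orbit z)) ∂P = ∫⁻ z, f z ∂P := by
  simp only [lintegral_unifOrbit_orbit]
  simpa only [Fintype.card_perm, Fintype.card_fin] using
    lintegral_inv_card_mul_sum_comp hP.measurePreserving hf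

end Orbits

section OrbitDensity

variable {Z : Type*} [MeasurableSpace Z] {n : ℕ}

/-- The mixture of the uniform distributions on the orbits with mixing law `ν`. -/
def orbitMixture (ν : Measure (Orbit n Z)) : Measure (Fin (n + 1) → Z) :=
  unifKernel n Z ∘ₘ ν

instance isProbabilityMeasure_orbitMixture (ν : Measure (Orbit n Z)) [IsProbabilityMeasure ν] :
    IsProbabilityMeasure (orbitMixture ν) :=
  inferInstanceAs (IsProbabilityMeasure (unifKernel n Z ∘ₘ ν))

lemma lintegral_orbitMixture (ν : Measure (Orbit n Z)) {f : (Fin (n + 1) → Z) → ℝ≥0∞}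
    (hf : Measurable f) :
    ∫⁻ z, f z ∂(orbitMixture ν) = ∫⁻ O, ∫⁻ w, f w ∂(unifOrbit O) ∂ν :=
  Measure.lintegral_bind (unifKernel n Z).aemeasurable hf.aemeasurable

lemma exchangeable_orbitMixture (ν : Measure (Orbit n Z)) : Exchangeable (orbitMixture ν) := by
  intro π
  have h_kernel : (unifKernel n Z).map (fun z => z ∘ π) = unifKernel n Z := by
    ext1 O
    rw [Kernel.map_apply _ (measurable_comp_perm π), unifKernel_apply, exchangeable_unifOrbit O π]
  rw [orbitMixture, Measure.map_comp _ _ (measurable_comp_perm π), h_kernel]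

/-- `D` is measurable and is a probability density with respect to the uniform distribution on
every single orbit, so that reweighting by `D` leaves the law of the orbit unchanged. -/
structure IsOrbitDensity (D : (Fin (n + 1) → Z) → ℝ≥0∞) : Prop where
  measurable : Measurable D
  lintegral_eq_one : ∀ O : Orbit n Z, ∫⁻ w, D w ∂(unifOrbit O) = 1

/-- The kernel sending an orbit `O` to the distribution on it with density `D` with respect to
`Unif(O)`. -/
def densityKernel (D : (Fin (n + 1) → Z) → ℝ≥0∞) : Kernel (Orbit n Z) (Fin (n + 1) → Z) :=
  (unifKernel n Z).withDensity fun _ => D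

/-- The law of the last entry on each orbit, when the tuple has density `D` with respect to the
uniform distribution on the orbit. -/
def lastKernel (D : (Fin (n + 1) → Z) → ℝ≥0∞) : Kernel (Orbit n Z) Z :=
  (densityKernel D).map fun w => w (Fin.last n)

variable {D : (Fin (n + 1) → Z) → ℝ≥0∞}

lemma densityKernel_apply (hD : Measurable D) (O : Orbit n Z) :
    densityKernel D O = (unifOrbit O).withDensity D := by
  have hD' : Measurable (Function.uncurry fun _ : Orbit n Z => D) := hD.comp measurable_snd
  exact Kernel.withDensity_apply _ hD' O

lemma lastKernel_apply (hD : Measurable D) (O : Orbit n Z) :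
    lastKernel D O = ((unifOrbit O).withDensity D).map fun w => w (Fin.last n) := by
  rw [lastKernel, Kernel.map_apply _ (measurable_pi_apply _), densityKernel_apply hD]

lemma IsOrbitDensity.isMarkovKernel_densityKernel (hD : IsOrbitDensity D) :
    IsMarkovKernel (densityKernel D) :=
  ⟨fun O => ⟨by rw [densityKernel_apply hD.measurable, withDensity_apply _ .univ,
    setLIntegral_univ, hD.lintegral_eq_one]⟩⟩

lemma IsOrbitDensity.isOrbitLaw_lastKernel (hD : IsOrbitDensity D) : IsOrbitLaw (lastKernel D) := by
  have := hD.isMarkovKernel_densityKernel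
  refine ⟨Kernel.IsMarkovKernel.map _ (measurable_pi_apply _), fun O => ?_⟩
  rw [lastKernel_apply hD.measurable, ← map_last_unifOrbit]
  exact (withDensity_absolutelyContinuous _ _).map (measurable_pi_apply _)

variable [MeasurableSingletonClass Z]

lemma lintegral_orbitMixture_prodMk (ν : Measure (Orbit n Z))
    {F : Orbit n Z × (Fin (n + 1) → Z) → ℝ≥0∞} (hF : Measurable F) :
    ∫⁻ z, F (orbit z, z) ∂(orbitMixture ν) = ∫⁻ O, ∫⁻ w, F (O, w) ∂(unifOrbit O) ∂ν := by
  rw [lintegral_orbitMixture ν (f := fun z => F (orbit z, z))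
    (hF.comp (measurable_orbit.prodMk measurable_id))]
  exact lintegral_congr fun O => lintegral_congr_ae (ae_unifOrbit_iff.2 fun w hw => by
    simp only [hw])

lemma map_orbit_withDensity_orbitMixture (ν : Measure (Orbit n Z)) (hD : Measurable D) :
    ((orbitMixture ν).withDensity D).map orbit =
      ν.withDensity fun O => ∫⁻ w, D w ∂(unifOrbit O) := by
  refine Measure.ext_of_lintegral _ fun f hf => ?_
  rw [lintegral_map hf measurable_orbit,
    lintegral_withDensity_eq_lintegral_mul _ hD (g := fun z => f (orbit z)) (by fun_prop),
    lintegral_withDensity_eq_lintegral_mul _ (measurable_lintegral_unifOrbit hD) hf]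
  refine (lintegral_orbitMixture_prodMk ν (F := fun p => D p.2 * f p.1) (by fun_prop)).trans
    (lintegral_congr fun O => ?_)
  exact lintegral_mul_const (f O) hD

lemma map_orbit_orbitMixture (ν : Measure (Orbit n Z)) : (orbitMixture ν).map orbit = ν := by
  simpa [withDensity_one] using
    map_orbit_withDensity_orbitMixture ν (D := fun _ => 1) measurable_const

lemma IsOrbitDensity.map_orbit_withDensity (hD : IsOrbitDensity D) (ν : Measure (Orbit n Z)) :
    ((orbitMixture ν).withDensity D).map orbit = ν := by
  rw [map_orbit_withDensity_orbitMixture ν hD.measurable]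
  simp only [hD.lintegral_eq_one]
  exact withDensity_one

lemma IsOrbitDensity.isProbabilityMeasure_withDensity (hD : IsOrbitDensity D)
    (ν : Measure (Orbit n Z)) [IsProbabilityMeasure ν] :
    IsProbabilityMeasure ((orbitMixture ν).withDensity D) := by
  rw [← Measure.isProbabilityMeasure_map_iff measurable_orbit.aemeasurable,
    hD.map_orbit_withDensity]
  infer_instance

lemma IsOrbitDensity.hasCondDistrib_densityKernel (hD : IsOrbitDensity D)
    (ν : Measure (Orbit n Z)) [SFinite ν] :
    HasCondDistrib id orbit (densityKernel D) ((orbitMixture ν).withDensity D) := by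
  have := hD.isMarkovKernel_densityKernel
  have h_pair : Measurable fun z : Fin (n + 1) → Z => (orbit z, id z) :=
    measurable_orbit.prodMk measurable_id
  refine ⟨h_pair.aemeasurable, Measure.ext_of_lintegral _ fun F hF => ?_⟩
  rw [hD.map_orbit_withDensity, lintegral_map hF h_pair,
    lintegral_withDensity_eq_lintegral_mul _ hD.measurable (g := fun z => F (orbit z, id z))
      (hF.comp h_pair),
    Measure.lintegral_compProd hF]
  refine (lintegral_orbitMixture_prodMk ν (F := fun p => D p.2 * F p)
    ((hD.measurable.comp measurable_snd).mul hF)).trans (lintegral_congr fun O => ?_)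
  rw [densityKernel_apply hD.measurable,
    lintegral_withDensity_eq_lintegral_mul _ hD.measurable (g := fun w => F (O, w))
      (hF.comp measurable_prodMk_left)]
  rfl

lemma IsOrbitDensity.hasCondDistrib_last (hD : IsOrbitDensity D) (ν : Measure (Orbit n Z))
    [IsProbabilityMeasure ν] :
    HasCondDistrib (fun z : Fin (n + 1) → Z => z (Fin.last n)) orbit (lastKernel D)
      ((orbitMixture ν).withDensity D) :=
  have := hD.isMarkovKernel_densityKernel
  have := hD.isProbabilityMeasure_withDensity ν
  (hD.hasCondDistrib_densityKernel ν).comp_left (measurable_pi_apply _)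

lemma absolutelyContinuous_orbitMixture (Q : Measure (Fin (n + 1) → Z)) :
    Q ≪ orbitMixture (Q.map orbit) := by
  intro s hs
  have h_ae : ∀ᵐ O ∂(Q.map orbit), ∀ᵐ w ∂(unifOrbit O), w ∉ s :=
    Measure.ae_ae_of_ae_bind (unifKernel n Z).aemeasurable (measure_eq_zero_iff_ae_notMem.1 hs)
  refine measure_eq_zero_iff_ae_notMem.2 ?_
  filter_upwards [ae_of_ae_map measurable_orbit.aemeasurable h_ae] with z hz
  exact ae_unifOrbit_iff.1 hz z rfl

lemma ae_lintegral_rnDeriv_orbitMixture_eq_one (Q : Measure (Fin (n + 1) → Z))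
    [IsProbabilityMeasure Q] :
    ∀ᵐ O ∂(Q.map orbit),
      ∫⁻ w, Q.rnDeriv (orbitMixture (Q.map orbit)) w ∂(unifOrbit O) = 1 := by
  have : IsProbabilityMeasure (Q.map orbit) :=
    Measure.isProbabilityMeasure_map measurable_orbit.aemeasurable
  have h_meas := Measure.measurable_rnDeriv Q (orbitMixture (Q.map orbit))
  refine (withDensity_eq_iff_of_sigmaFinite (g := 1)
    (measurable_lintegral_unifOrbit h_meas).aemeasurable aemeasurable_const).1 ?_
  rw [← map_orbit_withDensity_orbitMixture _ h_meas,
    Measure.withDensity_rnDeriv_eq _ _ (absolutelyContinuous_orbitMixture Q), withDensity_one]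

open Classical in
lemma exists_isOrbitDensity_withDensity_eq (Q : Measure (Fin (n + 1) → Z))
    [IsProbabilityMeasure Q] :
    ∃ D, IsOrbitDensity D ∧ (orbitMixture (Q.map orbit)).withDensity D = Q := by
  set ν := Q.map orbit
  have : IsProbabilityMeasure ν := Measure.isProbabilityMeasure_map measurable_orbit.aemeasurable
  set D := Q.rnDeriv (orbitMixture ν)
  have hD : Measurable D := Measure.measurable_rnDeriv _ _
  let S : Set (Orbit n Z) := {O | ∫⁻ w, D w ∂(unifOrbit O) = 1}
  have hS : MeasurableSet S := measurable_lintegral_unifOrbit hD (measurableSet_singleton 1)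
  refine ⟨(orbit ⁻¹' S).piecewise D 1,
    ⟨hD.piecewise (measurable_orbit hS) measurable_one, fun O => ?_⟩, ?_⟩
  · by_cases hO : O ∈ S
    · rw [← show ∫⁻ w, D w ∂(unifOrbit O) = 1 from hO]
      exact lintegral_congr_ae (ae_unifOrbit_iff.2 fun w hw =>
        Set.piecewise_eq_of_mem _ _ _ (Set.mem_preimage.2 (hw ▸ hO)))
    · rw [← measure_univ (μ := unifOrbit O), ← lintegral_one]
      exact lintegral_congr_ae (ae_unifOrbit_iff.2 fun w hw =>
        Set.piecewise_eq_of_notMem _ _ _ fun h => hO (hw ▸ h))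
  · have h_mem : ∀ᵐ z ∂(orbitMixture ν), orbit z ∈ S := by
      refine ae_of_ae_map measurable_orbit.aemeasurable ?_
      rw [map_orbit_orbitMixture]
      exact ae_lintegral_rnDeriv_orbitMixture_eq_one Q
    have h_eq : (orbit ⁻¹' S).piecewise D 1 =ᵐ[orbitMixture ν] D :=
      h_mem.mono fun z hz => Set.piecewise_eq_of_mem _ _ _ hz
    rw [withDensity_congr_ae h_eq,
      Measure.withDensity_rnDeriv_eq _ _ (absolutelyContinuous_orbitMixture Q)]

lemma exists_isOrbitLaw_hasCondDistrib (Q : Measure (Fin (n + 1) → Z)) [IsProbabilityMeasure Q] :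
    ∃ κ : Kernel (Orbit n Z) Z, IsOrbitLaw κ ∧
      HasCondDistrib (fun z : Fin (n + 1) → Z => z (Fin.last n)) orbit κ Q := by
  have := Measure.isProbabilityMeasure_map (μ := Q) measurable_orbit.aemeasurable
  obtain ⟨D, hD, hQ⟩ := exists_isOrbitDensity_withDensity_eq Q
  exact ⟨lastKernel D, hD.isOrbitLaw_lastKernel, hQ ▸ hD.hasCondDistrib_last _⟩

end OrbitDensity

section Uniqueness

variable {Z : Type*} {n : ℕ}

/-- The symmetrization of `f` over the permutations of the first `n` coordinates, which are
encoded as the permutations of all `n + 1` coordinates that fix the last one. -/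
def firstMean (f : (Fin (n + 1) → Z) → ℝ≥0∞) (z : Fin (n + 1) → Z) : ℝ≥0∞ :=
  (Fintype.card (MulAction.stabilizer (Equiv.Perm (Fin (n + 1))) (Fin.last n)) : ℝ≥0∞)⁻¹ *
    ∑ τ : MulAction.stabilizer (Equiv.Perm (Fin (n + 1))) (Fin.last n), f (z ∘ τ.1)

lemma firstMean_comp_perm (f : (Fin (n + 1) → Z) → ℝ≥0∞) (z : Fin (n + 1) → Z)
    {π : Equiv.Perm (Fin (n + 1))} (hπ : π (Fin.last n) = Fin.last n) :
    firstMean f (z ∘ π) = firstMean f z :=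
  congrArg (_⁻¹ * ·) <| Fintype.sum_equiv
    (Equiv.mulLeft (⟨π, hπ⟩ : MulAction.stabilizer (Equiv.Perm (Fin (n + 1))) (Fin.last n)))
    _ _ fun _ => rfl

variable [MeasurableSpace Z]

lemma measurable_firstMean {f : (Fin (n + 1) → Z) → ℝ≥0∞} (hf : Measurable f) :
    Measurable (firstMean f) :=
  (Finset.measurable_sum _ fun τ _ => hf.comp (measurable_comp_perm τ.1)).const_mul _

lemma FirstExchangeable.lintegral_firstMean {Q : Measure (Fin (n + 1) → Z)}
    (hQ : FirstExchangeable Q) {f : (Fin (n + 1) → Z) → ℝ≥0∞} (hf : Measurable f) :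
    ∫⁻ z, firstMean f z ∂Q = ∫⁻ z, f z ∂Q :=
  lintegral_inv_card_mul_sum_comp (fun τ => hQ.measurePreserving τ.2) hf

variable [MeasurableEq Z]

lemma measurable_setLIntegral_unifOrbit_last {h : (Fin (n + 1) → Z) → ℝ≥0∞} (hh : Measurable h) :
    Measurable fun p : Orbit n Z × Z =>
      ∫⁻ w in {w | w (Fin.last n) = p.2}, h w ∂(unifOrbit p.1) := by
  have h_set : MeasurableSet {q : (Orbit n Z × Z) × (Fin (n + 1) → Z) |
      q.2 (Fin.last n) = q.1.2} :=
    measurableSet_eq_fun (by fun_prop) (by fun_prop)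
  simp only [← lintegral_indicator (measurableSet_last_eq _)]
  exact ((hh.comp measurable_snd).indicator h_set).lintegral_kernel_prod_right'
    (κ := (unifKernel n Z).comap Prod.fst measurable_fst)

lemma exists_measurable_eq_orbit_last {h : (Fin (n + 1) → Z) → ℝ≥0∞} (hh : Measurable h)
    (h_perm : ∀ z, ∀ π : Equiv.Perm (Fin (n + 1)), π (Fin.last n) = Fin.last n →
      h (z ∘ π) = h z) :
    ∃ H : Orbit n Z × Z → ℝ≥0∞, Measurable H ∧ ∀ z, H (orbit z, z (Fin.last n)) = h z := by
  refine ⟨fun p => (∫⁻ w in {w | w (Fin.last n) = p.2}, h w ∂(unifOrbit p.1)) /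
      ∫⁻ _ in {w | w (Fin.last n) = p.2}, 1 ∂(unifOrbit p.1),
    (measurable_setLIntegral_unifOrbit_last hh).div
      (measurable_setLIntegral_unifOrbit_last measurable_const), fun z => ?_⟩
  have h_const : ∫⁻ w in {w | w (Fin.last n) = z (Fin.last n)}, h w ∂(unifOrbit (orbit z)) =
      h z * unifOrbit (orbit z) {w | w (Fin.last n) = z (Fin.last n)} := by
    rw [← setLIntegral_const]
    refine setLIntegral_congr_fun_ae (measurableSet_last_eq _)
      (ae_unifOrbit_iff.2 fun w hw hw_last => ?_)
    obtain ⟨π, hπ, rfl⟩ := exists_perm_fixing_last hw hw_last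
    exact h_perm z π hπ
  simp only [h_const, setLIntegral_one]
  exact ENNReal.mul_div_cancel_right (unifOrbit_last_eq_ne_zero z) (measure_ne_top _ _)

lemma FirstExchangeable.ext {Q Q' : Measure (Fin (n + 1) → Z)} (hQ : FirstExchangeable Q)
    (hQ' : FirstExchangeable Q')
    (h : Q.map (fun z => (orbit z, z (Fin.last n))) =
      Q'.map (fun z => (orbit z, z (Fin.last n)))) : Q = Q' := by
  refine Measure.ext_of_lintegral _ fun f hf => ?_
  obtain ⟨H, hH_meas, hH⟩ := exists_measurable_eq_orbit_last (measurable_firstMean hf)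
    fun z π hπ => firstMean_comp_perm f z hπ
  rw [← hQ.lintegral_firstMean hf, ← hQ'.lintegral_firstMean hf]
  simp only [← hH]
  rw [← lintegral_map hH_meas measurable_orbit_last, h,
    lintegral_map hH_meas measurable_orbit_last]

end Uniqueness

section LikelihoodRatio

variable {Z : Type*} [MeasurableSpace Z] {n : ℕ}

/-- The likelihood ratio `LR(z_{n+1} | O(z))` of the last observation, as a function of the whole
tuple. -/
def likelihoodRatio (κ : Kernel (Orbit n Z) Z) (z : Fin (n + 1) → Z) : ℝ≥0∞ :=
  lastLR κ (orbit z) (z (Fin.last n))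

/-- The alternative with orbit-conditional law `κ` of the last observation and law `ν` of the
orbit. -/
def alternative (κ : Kernel (Orbit n Z) Z) (ν : Measure (Orbit n Z)) :
    Measure (Fin (n + 1) → Z) :=
  (orbitMixture ν).withDensity (likelihoodRatio κ)

variable {κ : Kernel (Orbit n Z) Z}

lemma likelihoodRatio_comp_perm (κ : Kernel (Orbit n Z) Z) (z : Fin (n + 1) → Z)
    {π : Equiv.Perm (Fin (n + 1))} (hπ : π (Fin.last n) = Fin.last n) :
    likelihoodRatio κ (z ∘ π) = likelihoodRatio κ z := by
  simp only [likelihoodRatio, orbit_comp_perm, Function.comp_apply, hπ]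

section SingletonClass

variable [MeasurableSingletonClass Z]

lemma IsOrbitLaw.likelihoodRatio_eq (hκ : IsOrbitLaw κ) (z : Fin (n + 1) → Z) :
    likelihoodRatio κ z =
      κ (orbit z) {z (Fin.last n)} / unifEntries (orbit z) {z (Fin.last n)} :=
  have := hκ.1
  rnDeriv_eq_measure_singleton_div (hκ.2 _) (unifEntries_singleton_last_ne_zero z)
    (measure_ne_top _ _)

lemma IsOrbitLaw.likelihoodRatio_ne_top (hκ : IsOrbitLaw κ) (z : Fin (n + 1) → Z) :
    likelihoodRatio κ z ≠ ∞ := by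
  have := hκ.1
  rw [hκ.likelihoodRatio_eq]
  exact ENNReal.div_ne_top (measure_ne_top _ _) (unifEntries_singleton_last_ne_zero z)

lemma IsOrbitLaw.map_last_withDensity_likelihoodRatio (hκ : IsOrbitLaw κ) (O : Orbit n Z) :
    ((unifOrbit O).withDensity (likelihoodRatio κ)).map (fun w => w (Fin.last n)) = κ O := by
  have := hκ.1
  have h_last : Measurable fun w : Fin (n + 1) → Z => w (Fin.last n) := measurable_pi_apply _
  have h_meas : Measurable (lastLR κ O) := Measure.measurable_rnDeriv _ _
  have h_ae : likelihoodRatio κ =ᵐ[unifOrbit O] lastLR κ O ∘ fun w => w (Fin.last n) :=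
    ae_unifOrbit_iff.2 fun w hw => by simp only [likelihoodRatio, hw, Function.comp_apply]
  rw [withDensity_congr_ae h_ae, map_withDensity_comp _ h_last h_meas, map_last_unifOrbit]
  exact Measure.withDensity_rnDeriv_eq _ _ (hκ.2 O)

lemma IsOrbitLaw.lintegral_likelihoodRatio (hκ : IsOrbitLaw κ) (O : Orbit n Z) :
    ∫⁻ w, likelihoodRatio κ w ∂(unifOrbit O) = 1 := by
  have := hκ.1
  rw [← setLIntegral_univ, ← withDensity_apply _ .univ, ← measure_univ (μ := κ O),
    ← hκ.map_last_withDensity_likelihoodRatio O, Measure.map_apply (measurable_pi_apply _) .univ,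
    Set.preimage_univ]

lemma IsOrbitLaw.frequently_likelihoodRatio_ne_zero (hκ : IsOrbitLaw κ) (O : Orbit n Z) :
    ∃ᵐ w ∂(unifOrbit O), likelihoodRatio κ w ≠ 0 := by
  intro h
  have h_zero : likelihoodRatio κ =ᵐ[unifOrbit O] 0 := h.mono fun w hw => not_not.1 hw
  exact one_ne_zero ((hκ.lintegral_likelihoodRatio O).symm.trans
    (lintegral_eq_zero_of_ae_eq_zero h_zero))

end SingletonClass

variable [MeasurableEq Z]

lemma IsOrbitLaw.measurable_likelihoodRatio (hκ : IsOrbitLaw κ) :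
    Measurable (likelihoodRatio κ) := by
  have := hκ.1
  have h_entries : Measurable fun p : Orbit n Z × Z => unifEntries p.1 {p.2} := by
    simpa only [entriesKernel_apply] using measurable_kernel_singleton (entriesKernel n Z)
  have h_ratio : Measurable fun p : Orbit n Z × Z => κ p.1 {p.2} / unifEntries p.1 {p.2} :=
    (measurable_kernel_singleton κ).div h_entries
  rw [funext hκ.likelihoodRatio_eq]
  exact h_ratio.comp measurable_orbit_last

lemma IsOrbitLaw.isOrbitDensity_likelihoodRatio (hκ : IsOrbitLaw κ) :
    IsOrbitDensity (likelihoodRatio κ) :=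
  ⟨hκ.measurable_likelihoodRatio, hκ.lintegral_likelihoodRatio⟩

lemma IsOrbitLaw.lastKernel_likelihoodRatio (hκ : IsOrbitLaw κ) :
    lastKernel (likelihoodRatio κ) = κ := by
  ext1 O
  rw [lastKernel_apply hκ.measurable_likelihoodRatio, hκ.map_last_withDensity_likelihoodRatio]

lemma IsOrbitLaw.firstExchangeable_alternative (hκ : IsOrbitLaw κ) (ν : Measure (Orbit n Z)) :
    FirstExchangeable (alternative κ ν) := fun π hπ =>
  map_withDensity_of_comp_eq ((exchangeable_orbitMixture ν).measurePreserving π)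
    hκ.measurable_likelihoodRatio (funext fun z => likelihoodRatio_comp_perm κ z hπ)

lemma IsOrbitLaw.isAlternative_alternative (hκ : IsOrbitLaw κ) (ν : Measure (Orbit n Z))
    [IsProbabilityMeasure ν] : IsAlternative κ (alternative κ ν) where
  prob := hκ.isOrbitDensity_likelihoodRatio.isProbabilityMeasure_withDensity ν
  first := hκ.firstExchangeable_alternative ν
  cond := by
    simpa only [hκ.lastKernel_likelihoodRatio, alternative] using
      hκ.isOrbitDensity_likelihoodRatio.hasCondDistrib_last ν

lemma IsOrbitLaw.map_orbit_alternative (hκ : IsOrbitLaw κ) (ν : Measure (Orbit n Z)) :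
    (alternative κ ν).map orbit = ν :=
  hκ.isOrbitDensity_likelihoodRatio.map_orbit_withDensity ν

lemma IsOrbitLaw.lintegral_alternative (hκ : IsOrbitLaw κ) (ν : Measure (Orbit n Z))
    {f : (Fin (n + 1) → Z) → ℝ≥0∞} (hf : Measurable f) :
    ∫⁻ z, f z ∂(alternative κ ν) =
      ∫⁻ O, ∫⁻ w, likelihoodRatio κ w * f w ∂(unifOrbit O) ∂ν := by
  rw [alternative, lintegral_withDensity_eq_lintegral_mul _ hκ.measurable_likelihoodRatio hf]
  exact lintegral_orbitMixture ν (hκ.measurable_likelihoodRatio.mul hf)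

lemma IsAlternative.eq_alternative (hκ : IsOrbitLaw κ) {Q : Measure (Fin (n + 1) → Z)}
    (hQ : IsAlternative κ Q) : Q = alternative κ (Q.map orbit) := by
  have := hQ.prob
  have := Measure.isProbabilityMeasure_map (μ := Q) measurable_orbit.aemeasurable
  have h_alt := hκ.isAlternative_alternative (Q.map orbit)
  refine hQ.first.ext h_alt.first ?_
  rw [hQ.cond.map_eq, h_alt.cond.map_eq, hκ.map_orbit_alternative]

end LikelihoodRatio

section EValue

variable {Z : Type*} [MeasurableSpace Z] {n : ℕ} {U : ℝ≥0∞ → ℝ≥0∞} {κ : Kernel (Orbit n Z) Z}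
  {lam : Orbit n Z → ℝ≥0}

lemma utilityEValue_eq (z : Fin (n + 1) → Z) :
    utilityEValue U κ lam z = invDeriv U (lam (orbit z) / likelihoodRatio κ z) := rfl

section SingletonClass

variable [MeasurableSingletonClass Z]

lemma lintegral_utilityEValue (lam : Orbit n Z → ℝ≥0) (O : Orbit n Z) :
    ∫⁻ w, utilityEValue U κ lam w ∂(unifOrbit O) =
      ∫⁻ w, invDeriv U (lam O / likelihoodRatio κ w) ∂(unifOrbit O) :=
  lintegral_congr_ae (ae_unifOrbit_iff.2 fun w hw => by simp only [utilityEValue_eq, hw])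

lemma exists_isNormalizer (hU : RegularUtility U) (hκ : IsOrbitLaw κ) :
    ∃ lam : Orbit n Z → ℝ≥0, IsNormalizer U κ lam := by
  suffices h : ∀ O : Orbit n Z, ∃ l : ℝ≥0,
      ∫⁻ w, invDeriv U (l / likelihoodRatio κ w) ∂(unifOrbit O) = 1 by
    choose lam hlam using h
    exact ⟨lam, fun O => (lintegral_utilityEValue lam O).trans (hlam O)⟩
  intro O
  obtain ⟨w, rfl, hw⟩ : ∃ w, orbit w = O ∧ likelihoodRatio κ w ≠ 0 := by
    by_contra! h
    exact hκ.frequently_likelihoodRatio_ne_zero O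
      (ae_unifOrbit_iff.2 fun w hw => not_not.2 (h w hw))
  have h_fact : ((n + 1).factorial : ℝ≥0∞) ≠ 0 := Nat.cast_ne_zero.2 (n + 1).factorial_ne_zero
  obtain ⟨l, hl⟩ := hU.exists_sum_invDeriv_eq
    (L := fun π : Equiv.Perm (Fin (n + 1)) => likelihoodRatio κ (w ∘ π))
    (fun π => hκ.likelihoodRatio_ne_top _) ⟨1, hw⟩ h_fact (ENNReal.natCast_ne_top _)
  refine ⟨l, ?_⟩
  rw [lintegral_unifOrbit_orbit, hl, ENNReal.inv_mul_cancel h_fact (ENNReal.natCast_ne_top _)]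

lemma IsNormalizer.pos (hU : RegularUtility U) (h : IsNormalizer U κ lam) (O : Orbit n Z) :
    0 < lam O := by
  refine pos_iff_ne_zero.2 fun h_zero => ?_
  have h_top := (lintegral_utilityEValue lam O).symm.trans (h O)
  simp [h_zero, hU.invDeriv_zero] at h_top

end SingletonClass

variable [MeasurableEq Z]

lemma measurable_utilityEValue (hU : RegularUtility U) (hκ : IsOrbitLaw κ) (hlam : Measurable lam) :
    Measurable (utilityEValue U κ lam) :=
  hU.continuous_invDeriv.measurable.comp
    ((hlam.comp measurable_orbit).coe_nnreal_ennreal.div hκ.measurable_likelihoodRatio)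

lemma IsNormalizer.le_iff (hU : RegularUtility U) (hκ : IsOrbitLaw κ) (h : IsNormalizer U κ lam)
    {O : Orbit n Z} {c : ℝ≥0} :
    lam O ≤ c ↔ ∫⁻ w, utilityEValue U κ (fun _ => c) w ∂(unifOrbit O) ≤ 1 := by
  rw [← h O, lintegral_utilityEValue, lintegral_utilityEValue]
  refine ⟨fun hc => lintegral_mono fun w => hU.invDeriv_strictAnti.antitone
    (ENNReal.div_le_div_right (ENNReal.coe_le_coe.2 hc) _), fun h_le => ?_⟩
  by_contra! hc
  refine h_le.not_gt (hU.lintegral_invDeriv_div_lt hκ.measurable_likelihoodRatio.aemeasurable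
    (ae_of_all _ hκ.likelihoodRatio_ne_top) (hκ.frequently_likelihoodRatio_ne_zero O)
    (ENNReal.coe_lt_coe.2 hc) ?_)
  rw [← lintegral_utilityEValue, h O]
  exact ENNReal.one_ne_top

lemma IsNormalizer.measurable (hU : RegularUtility U) (hκ : IsOrbitLaw κ)
    (h : IsNormalizer U κ lam) : Measurable lam := by
  refine measurable_of_Iic fun c => ?_
  have h_set : lam ⁻¹' Set.Iic c =
      {O | ∫⁻ w, utilityEValue U κ (fun _ => c) w ∂(unifOrbit O) ≤ 1} :=
    Set.ext fun O => h.le_iff hU hκ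
  rw [h_set]
  exact measurableSet_le (measurable_lintegral_unifOrbit
    (measurable_utilityEValue hU hκ measurable_const)) measurable_const

lemma IsNormalizer.isEValue (hU : RegularUtility U) (hκ : IsOrbitLaw κ)
    (h : IsNormalizer U κ lam) : IsEValue (utilityEValue U κ lam) := by
  have h_meas := measurable_utilityEValue hU hκ (h.measurable hU hκ)
  refine ⟨h_meas, fun P hP h_exch => ?_⟩
  rw [← h_exch.lintegral_lintegral_unifOrbit h_meas]
  simp only [h _, lintegral_one, measure_univ, le_refl]

lemma IsNormalizer.lintegral_likelihoodRatio_mul_utility_le (hU : RegularUtility U)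
    (hκ : IsOrbitLaw κ) (h : IsNormalizer U κ lam) {ε' : (Fin (n + 1) → Z) → ℝ≥0∞}
    (hε' : IsEValue ε') (O : Orbit n Z) :
    ∫⁻ w, likelihoodRatio κ w * U (ε' w) ∂(unifOrbit O) ≤
      ∫⁻ w, likelihoodRatio κ w * U (utilityEValue U κ lam w) ∂(unifOrbit O) := by
  set ε := utilityEValue U κ lam
  have hε : Measurable ε := (h.isEValue hU hκ).measurable
  have h_pointwise : ∀ᵐ w ∂(unifOrbit O), likelihoodRatio κ w * U (ε' w) + lam O * ε w ≤
      likelihoodRatio κ w * U (ε w) + lam O * ε' w := by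
    refine ae_unifOrbit_iff.2 fun w hw => ?_
    subst hw
    exact hU.mul_add_mul_invDeriv_le (ENNReal.coe_ne_zero.2 (h.pos hU _).ne') ENNReal.coe_ne_top
      (hκ.likelihoodRatio_ne_top w) (hε'.ne_top w)
  -- The multiplier has to be cancelled on each orbit: it need not be integrable over the orbits.
  refine (ENNReal.add_le_add_iff_right (ENNReal.coe_ne_top (r := lam O))).1 ?_
  calc ∫⁻ w, likelihoodRatio κ w * U (ε' w) ∂(unifOrbit O) + lam O
    _ = ∫⁻ w, likelihoodRatio κ w * U (ε' w) + lam O * ε w ∂(unifOrbit O) := by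
      rw [lintegral_add_right _ (hε.const_mul _), lintegral_const_mul _ hε, h O, mul_one]
    _ ≤ ∫⁻ w, likelihoodRatio κ w * U (ε w) + lam O * ε' w ∂(unifOrbit O) :=
      lintegral_mono_ae h_pointwise
    _ = ∫⁻ w, likelihoodRatio κ w * U (ε w) ∂(unifOrbit O) +
          lam O * ∫⁻ w, ε' w ∂(unifOrbit O) := by
      rw [lintegral_add_right _ (hε'.measurable.const_mul _),
        lintegral_const_mul _ hε'.measurable]
    _ ≤ ∫⁻ w, likelihoodRatio κ w * U (ε w) ∂(unifOrbit O) + lam O := by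
      gcongr
      exact mul_le_of_le_one_right' (hε'.lintegral_unifOrbit_le O)

lemma IsNormalizer.isOptimalEValue (hU : RegularUtility U) (hκ : IsOrbitLaw κ)
    (h : IsNormalizer U κ lam) {Q : Measure (Fin (n + 1) → Z)} (hQ : IsAlternative κ Q) :
    IsOptimalEValue U Q (utilityEValue U κ lam) := by
  have hε := h.isEValue hU hκ
  refine ⟨hε, fun ε' hε' => ?_⟩
  have h_int {δ : (Fin (n + 1) → Z) → ℝ≥0∞} (hδ : IsEValue δ) : ∫⁻ z, U (δ z) ∂Q =
      ∫⁻ O, ∫⁻ w, likelihoodRatio κ w * U (δ w) ∂(unifOrbit O) ∂(Q.map orbit) := by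
    conv_lhs => rw [hQ.eq_alternative hκ]
    exact hκ.lintegral_alternative _ (hU.mono.measurable.comp hδ.measurable)
  rw [h_int hε', h_int hε]
  exact lintegral_mono fun O => h.lintegral_likelihoodRatio_mul_utility_le hU hκ hε' O

end EValue

end FuzzyConformal

end

open FuzzyConformal in
theorem mainTheorem3 {Z : Type*} [MeasurableSpace Z] [MeasurableEq Z] (n : ℕ)
    (U : ℝ≥0∞ → ℝ≥0∞) (hU : RegularUtility U) :
    -- every alternative with exchangeable first observations has an orbit-conditional law
    (∀ Q : Measure (Fin (n + 1) → Z), IsProbabilityMeasure Q → FirstExchangeable Q →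
      ∃ κ : Kernel (Orbit n Z) Z, IsOrbitLaw κ ∧ IsAlternative κ Q) ∧
    ∀ κ : Kernel (Orbit n Z) Z, IsOrbitLaw κ →
      -- the alternatives with orbit-conditional law `κ` are the mixtures over orbits
      (∀ ν : Measure (Orbit n Z), IsProbabilityMeasure ν →
        ∃! Q : Measure (Fin (n + 1) → Z), IsAlternative κ Q ∧ Q.map orbit = ν) ∧
      (∃ lam : Orbit n Z → ℝ≥0, IsNormalizer U κ lam) ∧
      ∀ lam : Orbit n Z → ℝ≥0, IsNormalizer U κ lam →
        (∀ O, 0 < lam O) ∧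
        IsEValue (utilityEValue U κ lam) ∧
        -- one and the same e-value is optimal against all of these alternatives
        ∀ Q : Measure (Fin (n + 1) → Z), IsAlternative κ Q →
          IsOptimalEValue U Q (utilityEValue U κ lam) := by
  refine ⟨fun Q hQ h_first => ?_, fun κ hκ => ⟨fun ν hν => ?_, exists_isNormalizer hU hκ,
    fun lam h => ⟨h.pos hU, h.isEValue hU hκ, fun Q hQ => h.isOptimalEValue hU hκ hQ⟩⟩⟩
  · obtain ⟨κ, hκ, h_cond⟩ := exists_isOrbitLaw_hasCondDistrib Q
    exact ⟨κ, hκ, hQ, h_first, h_cond⟩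
  · refine ⟨alternative κ ν, ⟨hκ.isAlternative_alternative ν, hκ.map_orbit_alternative ν⟩, ?_⟩
    rintro Q ⟨hQ, rfl⟩
    exact hQ.eq_alternative hκ
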